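/- Let $0\le M_1<M<N$ be integers, $\omega:=e^{-2\pi i/(2N)}$, $I:=\{0,\dots,2N-1\}$. Let $\gamma_1,\dots,\gamma_M\in\mathbb C\setminus\{0\}$, and let $z_1,\dots,z_M\in\mathbb C\setminus\{0\}$ be pairwise distinct, with $z_j\notin\{\omega^{-k}:k\in I\}$ for $j\le M_1$ and $z_j\in\{\omega^{-k}:k\in I\}$ for $j>M_1$. Put $$f_1(t)=\sum_{j=1}^{M_1}\gamma_jz_j^t,\qquad f_2(t)=\sum_{j=M_1+1}^{M}\gamma_jz_j^t,\qquad f=f_1+f_2,$$ let $\hat f_k=\sum_{\ell=0}^{2N-1}f(\ell)\,\omega^{k\ell}$, $k\in I$, be the DFT of the samples of $f$ (similarly $(\hat f_1)_k$ for $f_1$), and let $g_k:=\omega^k\hat f_k$. The modified AAA algorithm, with thresholds $\delta,\varepsilon,tol\ge 0$, is the following. In step $J=1$ take $S_1=\{k_1\}$ with $k_1\in\operatorname{argmax}_{k\in I}|g_k|$. In step $J\ge1$ put $\Gamma_J=I\setminus S_J$, form the Loewner matrix $$L_J=\Big(\frac{g_\ell-g_k}{\omega^{-\ell}-\omega^{-k}}\Big)_{\ell\in\Gamma_J,\,k\in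 S_J},$$ take a unit vector $w=(w_k)_{k\in S_J}$ minimizing $\|L_Jw\|_2$ (a right singular vector for the smallest singular value), and put $$\tilde p(x)=\sum_{k\in S_J}\frac{w_kg_k}{x-\omega^{-k}},\qquad \tilde q(x)=\sum_{k\in S_J}\frac{w_k}{x-\omega^{-k}},\qquad r_\ell=\tilde p(\omega^{-\ell})/\tilde q(\omega^{-\ell})\quad(\ell\in\Gamma_J),$$ with an arbitrary convention for $r_\ell$ where $\tilde q(\omega^{-\ell})=0$. Stop if $\|L_Jw\|_2\le\delta$ (i.e. $w$ is numerically a kernel vector), or if, for all $\ell\in\Gamma_J$, $\tilde q(\omega^{-\ell})\ne0$ and $|r_\ell-g_\ell|<tol$. Otherwise put $S_{J+1}=S_J\cup\{k\}$ with some $k\in\operatorname{argmax}_{\ell\in\Gamma_J}|r_\ell-g_\ell|$ and go on. After the last step delete from $\tilde p$ and $\tilde q$ the terms with $|w_k|\le\varepsilon$, let $r$ be the rational function $\tilde p/\tilde q$ written in lowest terms (i.e. all Froissart doublets, the common zeros of numerator and denominator, are removed), and let $$\Sigma=\{k\in S_J:|w_k|\le\varepsilon\}\cup\{\ell\in\Gamma_J:|r(\omega^{-\ell})-g_\ell|>tol\}.$$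 Then there is $\tau>0$ (depending on $N$ and on the $\gamma_j,z_j$) such that, for all $\delta,\varepsilon,tol\in[0,\tau)$ and for every choice made in ties of the argmax and among the minimizers $w$, the algorithm does not stop in the steps $J\le M$ (and can be continued there), and it terminates after exactly $M+1$ steps. It yields a partition $S_{M+1}\cup\Gamma_{M+1}=I$ with $\#S_{M+1}=M+1$ and a weight vector with $L_{M+1}w=0$, and moreover: 1. $r$ is of type $(M_1-1,M_1)$: in lowest terms its numerator has degree less than $M_1$ (it is $0$ if $M_1=0$) and its denominator has degree $M_1$. 2. $r$ has no pole at any node and $r(\omega^{-\ell})=\omega^{\ell}(\hat f_1)_\ell$ for all $\ell=0,\dots,2N-1$. 3. $\Sigma=\{k\in I:\omega^{-k}\in\{z_{M_1+1},\dots,z_M\}\}$, so that $\Sigma$ identifies the knots of $f_2$. 4. All parameters are recovered: $$r(x)=\sum_{j=1}^{M_1}\frac{\gamma_j(1-z_j^{2N})}{x-z_j}.$$ The pairs $(z_j,\gamma_j)$, $j\le M_1$, are exactly the pairs $\big(x,\operatorname{Res}_x r/(1-x^{2N})\big)$ with $x$ a pole of $r$, and the pairs $(z_j,\gamma_j)$,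 $j>M_1$, are exactly the pairs $\big(\omega^{-k},(g_k-r(\omega^{-k}))/(2N\omega^{k})\big)$ with $k\in\Sigma$. -/

import Mathlib

open scoped BigOperators

noncomputable section

namespace ESPIRA

/-- The root of unity `ω_{2N} = exp (-2πi / (2N))`. -/
def dftRoot (N : ℕ) : ℂ :=
  Complex.exp (-(2 * (Real.pi : ℂ) * Complex.I) / (2 * (N : ℂ)))

/-- The node `ω_{2N}^{-k}`. -/
def node (N : ℕ) (k : Fin (2 * N)) : ℂ :=
  (dftRoot N ^ (k : ℕ))⁻¹

/-- The exponential sum `t ↦ ∑_{j ∈ s} γ_j z_j^t`, restricted to the terms with index in `s`. -/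
def expSum {M : ℕ} (s : Finset (Fin M)) (γ z : Fin M → ℂ) (t : ℕ) : ℂ :=
  ∑ j ∈ s, γ j * z j ^ t

/-- The DFT of length `2N` of the samples `f 0, …, f (2N-1)`. -/
def dft (N : ℕ) (f : ℕ → ℂ) (k : Fin (2 * N)) : ℂ :=
  ∑ l : Fin (2 * N), f (l : ℕ) * dftRoot N ^ ((k : ℕ) * (l : ℕ))

/-- The scaled DFT coefficients `g_k = ω_{2N}^k f̂_k`, the data to be interpolated. -/
def scaledDft (N : ℕ) (f : ℕ → ℂ) (k : Fin (2 * N)) : ℂ :=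
  dftRoot N ^ (k : ℕ) * dft N f k

/-- The Loewner matrix of the data `g` for the partition of the index set into `S` (columns)
and its complement `Γ` (rows). -/
def loewner (N : ℕ) (g : Fin (2 * N) → ℂ) (S : Finset (Fin (2 * N))) :
    Matrix {l : Fin (2 * N) // l ∉ S} {k : Fin (2 * N) // k ∈ S} ℂ :=
  Matrix.of fun l k => (g l - g k) / (node N l - node N k)

/-- The Euclidean norm of a finite complex vector. -/
def norm2 {n : Type*} [Fintype n] (v : n → ℂ) : ℝ :=
  ‖WithLp.toLp 2 v‖

/-- `w` is a normalized right singular vector for the smallest singular value of `A`, that is, a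
minimizer of `‖A v‖₂` over the unit vectors; the smallest singular value is then `‖A w‖₂`.
(Used only for matrices with at least as many rows as columns.) -/
def IsSmallestSingularVector {m n : Type*} [Fintype m] [Fintype n]
    (A : Matrix m n ℂ) (w : n → ℂ) : Prop :=
  norm2 w = 1 ∧ ∀ v : n → ℂ, norm2 v = 1 → norm2 (A.mulVec w) ≤ norm2 (A.mulVec v)

/-- The barycentric numerator `p̃(x) = ∑_{k ∈ S} w_k g_k / (x - ω^{-k})` at `x = ω^{-l}`. -/
def baryNum (N : ℕ) (g : Fin (2 * N) → ℂ) (S : Finset (Fin (2 * N)))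
    (w : {k : Fin (2 * N) // k ∈ S} → ℂ) (l : Fin (2 * N)) : ℂ :=
  ∑ k : {k : Fin (2 * N) // k ∈ S}, w k * g k / (node N l - node N k)

/-- The barycentric denominator `q̃(x) = ∑_{k ∈ S} w_k / (x - ω^{-k})` at `x = ω^{-l}`. -/
def baryDen (N : ℕ) (S : Finset (Fin (2 * N)))
    (w : {k : Fin (2 * N) // k ∈ S} → ℂ) (l : Fin (2 * N)) : ℂ :=
  ∑ k : {k : Fin (2 * N) // k ∈ S}, w k / (node N l - node N k)

/-- The greedy choice of the next interpolation index: `k ∈ Γ` maximizes `|r_l - g_l|` over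
`l ∈ Γ`, where `r_l = p̃ / q̃` at `ω^{-l}`. Where the quotient is undefined, no convention about the
value `r_l` is imposed. -/
def IsGreedyIndex (N : ℕ) (g : Fin (2 * N) → ℂ) (S : Finset (Fin (2 * N)))
    (w : {k : Fin (2 * N) // k ∈ S} → ℂ) (k : Fin (2 * N)) : Prop :=
  k ∉ S ∧ ∃ r : Fin (2 * N) → ℂ,
    (∀ l, l ∉ S → baryDen N S w l ≠ 0 → r l = baryNum N g S w l / baryDen N S w l) ∧
    ∀ l, l ∉ S → ‖r l - g l‖ ≤ ‖r k - g k‖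

/-- The stopping test: either the smallest singular value `‖L w‖₂` of the Loewner matrix is at
most `δ` (numerically, `w` is a kernel vector), or all residuals on `Γ` are smaller than `tol`. -/
def Stops (N : ℕ) (g : Fin (2 * N) → ℂ) (δ tol : ℝ) (S : Finset (Fin (2 * N)))
    (w : {k : Fin (2 * N) // k ∈ S} → ℂ) : Prop :=
  norm2 ((loewner N g S).mulVec w) ≤ δ ∨
    ∀ l, l ∉ S → baryDen N S w l ≠ 0 ∧ ‖baryNum N g S w l / baryDen N S w l - g l‖ < tol

/-- One continuation of the iteration: the state `(S, w)` does not pass the stopping test, a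
greedy index is added to `S`, and a new weight vector is computed. -/
def Step (N : ℕ) (g : Fin (2 * N) → ℂ) (δ tol : ℝ)
    (S : Finset (Fin (2 * N))) (w : {k : Fin (2 * N) // k ∈ S} → ℂ)
    (S' : Finset (Fin (2 * N))) (w' : {k : Fin (2 * N) // k ∈ S'} → ℂ) : Prop :=
  ¬ Stops N g δ tol S w ∧
  (∃ k, IsGreedyIndex N g S w k ∧ S' = insert k S) ∧
  IsSmallestSingularVector (loewner N g S') w'

/-- `Reaches N g δ tol J S w`: some run of the iteration on the data `g` (ties in the greedy choice
and the choice of the singular vector being arbitrary) performs step `J`, with index set `S = S_J`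
and weight vector `w`. -/
inductive Reaches (N : ℕ) (g : Fin (2 * N) → ℂ) (δ tol : ℝ) :
    ℕ → (S : Finset (Fin (2 * N))) → ({k : Fin (2 * N) // k ∈ S} → ℂ) → Prop
  | init (k : Fin (2 * N)) (hk : ∀ l, ‖g l‖ ≤ ‖g k‖)
      (w : {i : Fin (2 * N) // i ∈ ({k} : Finset (Fin (2 * N)))} → ℂ)
      (hw : IsSmallestSingularVector (loewner N g {k}) w) :
      Reaches N g δ tol 1 {k} w
  | step (J : ℕ) (S : Finset (Fin (2 * N))) (w : {k : Fin (2 * N) // k ∈ S} → ℂ)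
      (S' : Finset (Fin (2 * N))) (w' : {k : Fin (2 * N) // k ∈ S'} → ℂ)
      (h : Reaches N g δ tol J S w) (hs : Step N g δ tol S w S' w') :
      Reaches N g δ tol (J + 1) S' w'

/-- The rational function `p̃ / q̃` in barycentric form after the terms with `|w_k| ≤ ε` have been
removed. Numerator `RatFunc.num` and denominator `RatFunc.denom` are coprime, so that passing to
them (and evaluating by means of them) is the removal of all Froissart doublets, that is, of the
common zeros of numerator and denominator. -/
def outputFun (N : ℕ) (g : Fin (2 * N) → ℂ) (ε : ℝ) (S : Finset (Fin (2 * N)))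
    (w : {k : Fin (2 * N) // k ∈ S} → ℂ) : RatFunc ℂ :=
  (∑ k : {k : Fin (2 * N) // k ∈ S} with ε < ‖w k‖,
      RatFunc.C (w k * g k) / (RatFunc.X - RatFunc.C (node N k))) /
  (∑ k : {k : Fin (2 * N) // k ∈ S} with ε < ‖w k‖,
      RatFunc.C (w k) / (RatFunc.X - RatFunc.C (node N k)))

/-- Value of a rational function, computed from its reduced fraction. -/
def value (r : RatFunc ℂ) (x : ℂ) : ℂ :=
  r.num.eval x / r.denom.eval x

/-- `Σ⁽¹⁾`: the indices in `S` whose weight is zero up to `ε`. -/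
def sigmaOne (N : ℕ) (ε : ℝ) (S : Finset (Fin (2 * N)))
    (w : {k : Fin (2 * N) // k ∈ S} → ℂ) : Set (Fin (2 * N)) :=
  {k | ∃ h : k ∈ S, ‖w ⟨k, h⟩‖ ≤ ε}

/-- `Σ⁽²⁾`: the indices in `Γ` at which the output function `r` misses the data by more
than `tol`. -/
def sigmaTwo (N : ℕ) (g : Fin (2 * N) → ℂ) (tol : ℝ) (S : Finset (Fin (2 * N)))
    (r : RatFunc ℂ) : Set (Fin (2 * N)) :=
  {l | l ∉ S ∧ tol < ‖value r (node N l) - g l‖}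

/-- The pairs (knot, coefficient) of `f₁` read off from `r`: the poles `x` of `r`, and the
residues of `r` there divided by `1 - x^{2N}`. -/
def recoveredOne (N : ℕ) (r : RatFunc ℂ) : Set (ℂ × ℂ) :=
  {p | r.denom.IsRoot p.1 ∧
    p.2 = r.num.eval p.1 / r.denom.derivative.eval p.1 / (1 - p.1 ^ (2 * N))}

/-- The pairs (knot, coefficient) of `f₂` read off from an index set `T` and from `r`: the nodes
`ω^{-k}`, `k ∈ T`, and the values `(g_k - r(ω^{-k})) / (2N ω^k)`. -/
def recoveredTwo (N : ℕ) (g : Fin (2 * N) → ℂ) (T : Set (Fin (2 * N))) (r : RatFunc ℂ) :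
    Set (ℂ × ℂ) :=
  {p | ∃ k ∈ T, p.1 = node N k ∧
    p.2 = (g k - value r (node N k)) / (2 * (N : ℂ) * dftRoot N ^ (k : ℕ))}

end ESPIRA

end

/-! A knot `z` that is not a node contributes, by the geometric sum, `γ (1 - z^(2N)) / (x_k - z)` to
`g_k` at the node `x_k`, while a knot that is a node contributes at its own index only. Hence `g` is
the partial fraction `A / D` of `f₁`, with `deg D = M₁`, perturbed exactly on a set `B` of `M - M₁`
indices.

Kernel vectors of the Loewner matrix for `S` correspond to pairs `(p, q)` of polynomials of degree
less than `#S` with `g_k q(x_k) = p(x_k)` at all `2N` nodes. If `#S ≤ M + 1`, then `A q - D p` has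
more zeros (the nodes outside `B`) than its degree allows, so `A q = D p` and, by coprimality, `q =
D v`, `p = A v`. At the nodes of `B` the data are wrong, which forces `v = 0` there. Thus `q = D P
u` and `p = A P u` with `P = ∏_{k ∈ B} (X - x_k)`, see `exists_eq_mul_of_linearized_interpolation`.
As `deg (D P) = M`, the kernel is trivial for `#S ≤ M` and a line for `#S = M + 1`. There the
weights vanish exactly on `S ∩ B`, and cancelling the Froissart factor `P` leaves `A / D`, from
which everything is read off.

The greedy rule plays no role beyond adding a new index. The threshold `τ` comes from compactness
(positive smallest singular values) and from the finiteness of the family of index sets. -/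

namespace ESPIRA

open Polynomial

/-! ### Partial fractions over a common denominator -/

section PartialFractions

variable {κ K : Type*} [Field K]

/-- The numerator of `∑_{k ∈ s} w_k / (X - x_k)` over the common denominator
`∏_{k ∈ s} (X - x_k)`. -/
noncomputable def pfNum [DecidableEq κ] (s : Finset κ) (x w : κ → K) : K[X] :=
  ∑ k ∈ s, C (w k) * ∏ i ∈ s.erase k, (X - C (x i))

/-- The common denominator `∏_{k ∈ s} (X - x_k)`. -/
noncomputable def pfDen (s : Finset κ) (x : κ → K) : K[X] :=
  ∏ k ∈ s, (X - C (x k))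

theorem pfDen_monic (s : Finset κ) (x : κ → K) : (pfDen s x).Monic :=
  monic_prod_of_monic _ _ fun _ _ => monic_X_sub_C _

theorem natDegree_pfDen (s : Finset κ) (x : κ → K) : (pfDen s x).natDegree = s.card := by
  simp [pfDen, natDegree_prod_of_monic _ _ fun i _ => monic_X_sub_C (x i)]

theorem degree_pfDen (s : Finset κ) (x : κ → K) : (pfDen s x).degree = s.card := by
  rw [degree_eq_natDegree (pfDen_monic s x).ne_zero, natDegree_pfDen]

theorem eval_pfDen (s : Finset κ) (x : κ → K) (y : K) :
    (pfDen s x).eval y = ∏ k ∈ s, (y - x k) := by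
  simp [pfDen, eval_prod]

theorem eval_pfDen_ne_zero {s : Finset κ} {x : κ → K} {y : K} (h : ∀ k ∈ s, y ≠ x k) :
    (pfDen s x).eval y ≠ 0 := by
  rw [eval_pfDen]
  exact Finset.prod_ne_zero_iff.2 fun k hk => sub_ne_zero.2 (h k hk)

theorem degree_pfNum_lt [DecidableEq κ] (s : Finset κ) (x w : κ → K) : (pfNum s x w).degree < s.card := by
  rw [pfNum, ← mem_degreeLT]
  refine Submodule.sum_mem _ fun k hk => ?_
  rw [mem_degreeLT]
  have h := degree_pfDen (s.erase k) x
  rw [pfDen] at h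
  rw [C_mul']
  refine (degree_smul_le _ _).trans_lt ?_
  rw [h, Nat.cast_lt]
  exact Finset.card_erase_lt_of_mem hk

theorem eval_pfNum_of_mem [DecidableEq κ] {s : Finset κ} (x w : κ → K) {k : κ} (hk : k ∈ s) :
    (pfNum s x w).eval (x k) = w k * ∏ i ∈ s.erase k, (x k - x i) := by
  rw [pfNum, eval_finsetSum, Finset.sum_eq_single_of_mem k hk]
  · simp [eval_prod]
  · intro b _ hbk
    rw [eval_mul, eval_prod,
      Finset.prod_eq_zero (Finset.mem_erase.2 ⟨hbk.symm, hk⟩) (by simp), mul_zero]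

theorem prod_erase_sub_ne_zero [DecidableEq κ] {s : Finset κ} {x : κ → K} (hx : Set.InjOn x s) {k : κ}
    (hk : k ∈ s) : ∏ i ∈ s.erase k, (x k - x i) ≠ 0 := by
  refine Finset.prod_ne_zero_iff.2 fun i hi => sub_ne_zero.2 fun h => ?_
  exact (Finset.mem_erase.1 hi).1 (hx (Finset.mem_erase.1 hi).2 hk h.symm)

theorem eval_pfNum [DecidableEq κ] {s : Finset κ} (x w : κ → K) {y : K} (hy : ∀ k ∈ s, y ≠ x k) :
    (pfNum s x w).eval y = (pfDen s x).eval y * ∑ k ∈ s, w k / (y - x k) := by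
  rw [pfNum, eval_finsetSum, Finset.mul_sum]
  refine Finset.sum_congr rfl fun k hk => ?_
  rw [eval_pfDen, ← Finset.mul_prod_erase s _ hk]
  have := sub_ne_zero.2 (hy k hk)
  simp only [eval_mul, eval_C, eval_prod, eval_sub, eval_X]
  field_simp

theorem eval_derivative_pfDen [DecidableEq κ] {s : Finset κ} (x : κ → K) {k : κ} (hk : k ∈ s) :
    (pfDen s x).derivative.eval (x k) = ∏ i ∈ s.erase k, (x k - x i) := by
  rw [pfDen, derivative_prod_finset, eval_finsetSum, Finset.sum_eq_single_of_mem k hk]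
  · simp [eval_prod]
  · intro b _ hbk
    rw [eval_mul, eval_prod,
      Finset.prod_eq_zero (Finset.mem_erase.2 ⟨hbk.symm, hk⟩) (by simp), zero_mul]

/-- Polynomials of degree less than `#s` are numerators of partial fractions. -/
theorem eq_pfNum [DecidableEq κ] {s : Finset κ} {x : κ → K} (hx : Set.InjOn x s) {p : K[X]}
    (hp : p.degree < s.card) :
    p = pfNum s x fun k => p.eval (x k) / ∏ i ∈ s.erase k, (x k - x i) := by
  refine eq_of_degrees_lt_of_eval_index_eq s hx hp (degree_pfNum_lt _ _ _) fun k hk => ?_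
  rw [eval_pfNum_of_mem x _ hk, div_mul_cancel₀ _ (prod_erase_sub_ne_zero hx hk)]

/-- At `x k` only the `k`-th summand of the numerator survives, and it is nonzero, so no linear
factor of the denominator divides the numerator. -/
theorem isCoprime_pfNum_pfDen [DecidableEq κ] {s : Finset κ} {x w : κ → K} (hx : Set.InjOn x s)
    (hw : ∀ k ∈ s, w k ≠ 0) : IsCoprime (pfNum s x w) (pfDen s x) := by
  refine IsCoprime.prod_right fun k hk => IsCoprime.symm ?_
  rw [(irreducible_X_sub_C (x k)).coprime_iff_not_dvd, dvd_iff_isRoot, IsRoot,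
    eval_pfNum_of_mem x w hk]
  exact mul_ne_zero (hw k hk) (prod_erase_sub_ne_zero hx hk)

theorem algebraMap_pfNum_div [DecidableEq κ] (s : Finset κ) (x w : κ → K) :
    algebraMap K[X] (RatFunc K) (pfNum s x w) / algebraMap K[X] (RatFunc K) (pfDen s x) =
      ∑ k ∈ s, RatFunc.C (w k) / (RatFunc.X - RatFunc.C (x k)) := by
  have hne : ∀ p : K[X], p.Monic → algebraMap K[X] (RatFunc K) p ≠ 0 := fun p hp =>
    RatFunc.algebraMap_ne_zero hp.ne_zero
  rw [pfNum, map_sum, Finset.sum_div]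
  refine Finset.sum_congr rfl fun k hk => ?_
  rw [pfDen, ← Finset.mul_prod_erase s _ hk, map_mul, map_mul, RatFunc.algebraMap_C,
    mul_div_mul_right _ _ (hne _ (monic_prod_of_monic _ _ fun i _ => monic_X_sub_C (x i))),
    map_sub, RatFunc.algebraMap_X, RatFunc.algebraMap_C]

end PartialFractions

/-! ### Linearized rational interpolation of perturbed data -/

section Interpolation

variable {κ ι K : Type*} [DecidableEq κ] [DecidableEq ι] [Fintype ι] [Field K]

/-- Linearized rational interpolation of data which agree with the partial fraction
`∑_{j ∈ s} a_j / (X - z_j)` at the points `x_k`, `k ∉ B`, and differ from it for `k ∈ B`. -/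
theorem exists_eq_mul_of_linearized_interpolation {s : Finset κ} {z a : κ → K}
    (hz : Set.InjOn z s) (ha : ∀ j ∈ s, a j ≠ 0) {x g : ι → K} (hx : Function.Injective x)
    (hzx : ∀ j ∈ s, ∀ k, x k ≠ z j) {B : Finset ι}
    (hgood : ∀ k ∉ B, g k = ∑ j ∈ s, a j / (x k - z j))
    (hbad : ∀ k ∈ B, g k ≠ ∑ j ∈ s, a j / (x k - z j))
    {J : ℕ} (hJ : s.card + J + B.card ≤ Fintype.card ι) {p q : K[X]}
    (hp : p.degree < J) (hq : q.degree < J) (h : ∀ k, g k * q.eval (x k) = p.eval (x k)) :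
    ∃ u : K[X], q = pfDen s z * pfDen B x * u ∧ p = pfNum s z a * pfDen B x * u := by
  have hD : ∀ k, (pfDen s z).eval (x k) ≠ 0 := fun k =>
    eval_pfDen_ne_zero fun j hj => hzx j hj k
  have hA : ∀ k, (pfNum s z a).eval (x k) =
      (pfDen s z).eval (x k) * ∑ j ∈ s, a j / (x k - z j) := fun k =>
    eval_pfNum z a fun j hj => hzx j hj k
  -- The difference of the two sides has degree less than `s.card + J`, which is at most the number
  -- of unperturbed points, and it vanishes at all of them.
  have key : pfNum s z a * q = pfDen s z * p := by
    refine eq_of_degree_sub_lt_of_eval_index_eq (s := Bᶜ) (v := x) hx.injOn ?_ ?_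
    · have hcard : ((s.card + J : ℕ) : WithBot ℕ) ≤ (Bᶜ.card : ℕ) := by
        rw [Nat.cast_le, Finset.card_compl]; omega
      refine lt_of_lt_of_le ?_ hcard
      refine (degree_sub_le _ _).trans_lt (max_lt ?_ ?_)
      · rcases eq_or_ne q 0 with rfl | hq0
        · simp
        · rw [degree_mul, Nat.cast_add]
          refine (add_le_add_left (degree_pfNum_lt s z a).le _).trans_lt ?_
          exact WithBot.add_lt_add_left (by simp) hq
      · rw [degree_mul, degree_pfDen, Nat.cast_add]
        exact WithBot.add_lt_add_left (by simp) hp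
    · intro k hk
      have hk' : k ∉ B := by simpa using hk
      rw [eval_mul, eval_mul, hA, ← h k, hgood k hk']
      ring
  obtain ⟨v, hv⟩ : pfDen s z ∣ q :=
    (isCoprime_pfNum_pfDen hz ha).symm.dvd_of_dvd_mul_left (Dvd.intro _ key.symm)
  have hpv : p = pfNum s z a * v := by
    refine mul_left_cancel₀ (pfDen_monic s z).ne_zero ?_
    rw [← key, hv]; ring
  have hBv : pfDen B x ∣ v := by
    refine Finset.prod_dvd_of_coprime ?_ fun k hk => ?_
    · intro i _ j _ hij
      exact isCoprime_X_sub_C_of_isUnit_sub (sub_ne_zero.2 (hx.ne hij)).isUnit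
    · rw [dvd_iff_isRoot, IsRoot]
      -- If `v` did not vanish at `x k`, dividing the interpolation condition by `D v` would make `g
      -- k` equal to the partial fraction.
      by_contra hvk
      refine hbad k hk ?_
      have := h k
      rw [hv, hpv, eval_mul, eval_mul, hA] at this
      refine mul_right_cancel₀ (mul_ne_zero (hD k) hvk) ?_
      rw [this]; ring
  obtain ⟨u, rfl⟩ := hBv
  exact ⟨u, by rw [hv]; ring, by rw [hpv]; ring⟩

end Interpolation

/-! ### Reduced fractions -/

section LowestTerms

variable {K : Type*} [Field K]

theorem num_denom_of_isCoprime {A D : K[X]} (hD : D.Monic) (h : IsCoprime A D) {r : RatFunc K}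
    (hr : r = algebraMap K[X] (RatFunc K) A / algebraMap K[X] (RatFunc K) D) :
    r.num = A ∧ r.denom = D := by
  have hcross : r.num * D = A * r.denom := by
    have := RatFunc.num_div_denom r
    rw [hr, div_eq_div_iff (RatFunc.algebraMap_ne_zero (RatFunc.denom_ne_zero _))
      (RatFunc.algebraMap_ne_zero hD.ne_zero), ← map_mul, ← map_mul] at this
    rw [hr]
    exact RatFunc.algebraMap_injective K this
  have hden : r.denom = D := by
    refine eq_of_monic_of_associated (RatFunc.monic_denom r) hD (associated_of_dvd_dvd ?_ ?_)
    · exact (RatFunc.isCoprime_num_denom r).symm.dvd_of_dvd_mul_left (Dvd.intro_left _ hcross.symm)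
    · exact h.symm.dvd_of_dvd_mul_left (Dvd.intro_left _ hcross)
  refine ⟨?_, hden⟩
  rw [hden] at hcross
  exact mul_right_cancel₀ hD.ne_zero hcross

end LowestTerms

/-! ### Nodes and the DFT of a single exponential -/

section Dft

variable {N : ℕ}

theorem isPrimitiveRoot_dftRoot (hN : N ≠ 0) : IsPrimitiveRoot (dftRoot N) (2 * N) := by
  have h := (Complex.isPrimitiveRoot_exp (2 * N) (by omega)).inv
  rw [← Complex.exp_neg] at h
  have he : dftRoot N = Complex.exp (-(2 * Real.pi * Complex.I / (2 * N : ℕ))) := by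
    unfold dftRoot
    congr 1
    push_cast
    ring
  rwa [he]

theorem dftRoot_ne_zero (N : ℕ) : dftRoot N ≠ 0 := Complex.exp_ne_zero _

theorem node_ne_zero (k : Fin (2 * N)) : node N k ≠ 0 :=
  inv_ne_zero (pow_ne_zero _ (dftRoot_ne_zero N))

theorem pos_of_index (k : Fin (2 * N)) : N ≠ 0 := by
  have := k.pos
  omega

theorem node_injective (N : ℕ) : Function.Injective (node N) := fun k l h =>
  Fin.ext ((isPrimitiveRoot_dftRoot (pos_of_index k)).pow_inj k.2 l.2 (inv_injective h))

theorem exists_node_eq (hN : N ≠ 0) {x : ℂ} (hx : x ^ (2 * N) = 1) : ∃ k, x = node N k := by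
  have : NeZero (2 * N) := ⟨by omega⟩
  obtain ⟨i, hi, h⟩ := (isPrimitiveRoot_dftRoot hN).eq_pow_of_pow_eq_one (ξ := x⁻¹)
    (by rw [inv_pow, hx, inv_one])
  exact ⟨⟨i, hi⟩, by rw [node, h, inv_inv]⟩

theorem scaledDft_expSum {M : ℕ} (s : Finset (Fin M)) (γ z : Fin M → ℂ) (k : Fin (2 * N)) :
    scaledDft N (expSum s γ z) k = ∑ j ∈ s, γ j * scaledDft N (fun t => z j ^ t) k := by
  simp only [scaledDft, dft, expSum, Finset.sum_mul, Finset.mul_sum]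
  rw [Finset.sum_comm]
  exact Finset.sum_congr rfl fun j _ => Finset.sum_congr rfl fun l _ => by ring

theorem scaledDft_pow (x : ℂ) (k : Fin (2 * N)) :
    scaledDft N (fun t => x ^ t) k =
      (node N k)⁻¹ * ∑ l ∈ Finset.range (2 * N), (x / node N k) ^ l := by
  rw [scaledDft, dft, Fin.sum_univ_eq_sum_range (fun l => x ^ l * dftRoot N ^ ((k : ℕ) * l)),
    node, inv_inv]
  congr 1
  refine Finset.sum_congr rfl fun l _ => ?_
  rw [div_inv_eq_mul, mul_pow, pow_mul]

theorem node_pow (k : Fin (2 * N)) : node N k ^ (2 * N) = 1 := by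
  rw [node, inv_pow, ← pow_mul, mul_comm, pow_mul,
    (isPrimitiveRoot_dftRoot (pos_of_index k)).pow_eq_one, one_pow, inv_one]

/-- Since the node is a `2N`-th root of unity, the geometric sum has a numerator independent of `k`;
the scaling by `ω^k` turns it into a simple fraction in the node. -/
theorem scaledDft_pow_of_ne {x : ℂ} {k : Fin (2 * N)} (h : x ≠ node N k) :
    scaledDft N (fun t => x ^ t) k = (1 - x ^ (2 * N)) / (node N k - x) := by
  have h0 := node_ne_zero k
  have h1 : x / node N k ≠ 1 := fun e => h ((div_eq_one_iff_eq h0).1 e)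
  have h2 : node N k - x ≠ 0 := sub_ne_zero.2 h.symm
  have h3 : x - node N k ≠ 0 := sub_ne_zero.2 h
  rw [scaledDft_pow, geom_sum_eq h1, div_pow, node_pow, div_one, div_sub_one h0]
  field_simp
  ring

theorem scaledDft_pow_self (k : Fin (2 * N)) :
    scaledDft N (fun t => node N k ^ t) k = 2 * N * dftRoot N ^ (k : ℕ) := by
  rw [scaledDft_pow, div_self (node_ne_zero k)]
  simp [node, mul_comm]

theorem scaledDft_pow_node_of_ne {k l : Fin (2 * N)} (h : l ≠ k) :
    scaledDft N (fun t => node N l ^ t) k = 0 := by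
  rw [scaledDft_pow_of_ne ((node_injective N).ne h), node_pow, sub_self, zero_div]

end Dft

theorem exists_pos_forall_le {ι : Type*} [Finite ι] {f : ι → ℝ} (hf : ∀ i, 0 < f i) :
    ∃ c : ℝ, 0 < c ∧ ∀ i, c ≤ f i := by
  rcases isEmpty_or_nonempty ι with _ | _
  · exact ⟨1, one_pos, isEmptyElim⟩
  · obtain ⟨i, hi⟩ := Finite.exists_min f
    exact ⟨f i, hf i, hi⟩

/-! ### Smallest singular vectors -/

section Norm2

variable {m n : Type*} [Fintype m] [Fintype n]

theorem norm2_eq_zero {v : n → ℂ} : norm2 v = 0 ↔ v = 0 := by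
  simp [norm2]

theorem norm2_smul (c : ℂ) (v : n → ℂ) : norm2 (c • v) = ‖c‖ * norm2 v := by
  rw [norm2, WithLp.toLp_smul, norm_smul, norm2]

theorem norm_le_norm2 (v : n → ℂ) (i : n) : ‖v i‖ ≤ norm2 v :=
  PiLp.norm_apply_le (WithLp.toLp 2 v) i

theorem norm2_le_sum (v : n → ℂ) : norm2 v ≤ ∑ i, ‖v i‖ := by
  classical
  have h : WithLp.toLp 2 v = ∑ i, EuclideanSpace.single i (v i) := by
    ext j
    simp [Finset.sum_apply, Pi.single_apply]
  rw [norm2, h]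
  refine (norm_sum_le _ _).trans (le_of_eq ?_)
  simp

theorem norm2_normalize {v : n → ℂ} (hv : v ≠ 0) : norm2 (((norm2 v)⁻¹ : ℂ) • v) = 1 := by
  have h : norm2 v ≠ 0 := mt norm2_eq_zero.1 hv
  have h0 : 0 ≤ norm2 v := norm_nonneg _
  rw [norm2_smul, norm_inv, Complex.norm_real, Real.norm_of_nonneg h0, inv_mul_cancel₀ h]

theorem exists_isSmallestSingularVector [Nonempty n] (A : Matrix m n ℂ) :
    ∃ w, IsSmallestSingularVector A w := by
  classical
  have hne : (Metric.sphere (0 : EuclideanSpace ℂ n) 1).Nonempty :=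
    NormedSpace.sphere_nonempty.2 zero_le_one
  have hcont : Continuous fun v : EuclideanSpace ℂ n => norm2 (A.mulVec v.ofLp) := by
    unfold norm2
    fun_prop
  obtain ⟨w, hw, hmin⟩ := (isCompact_sphere (0 : EuclideanSpace ℂ n) 1).exists_isMinOn hne
    hcont.continuousOn
  refine ⟨w.ofLp, by simpa [norm2] using hw, fun v hv => ?_⟩
  exact hmin (show WithLp.toLp 2 v ∈ _ by simpa [norm2] using hv)

/-- A matrix with trivial kernel is bounded below on unit vectors. -/
theorem exists_pos_le_norm2_mulVec [Nonempty n] {A : Matrix m n ℂ}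
    (hA : ∀ v, A.mulVec v = 0 → v = 0) :
    ∃ σ : ℝ, 0 < σ ∧ ∀ v, norm2 v = 1 → σ ≤ norm2 (A.mulVec v) := by
  obtain ⟨w, hw, hmin⟩ := exists_isSmallestSingularVector A
  refine ⟨norm2 (A.mulVec w), lt_of_le_of_ne (norm_nonneg _) fun h => ?_, hmin⟩
  have hw0 := hA w (norm2_eq_zero.1 h.symm)
  rw [norm2_eq_zero.2 hw0] at hw
  exact zero_ne_one hw

/-- A nontrivial kernel makes the minimum zero, so every minimizer lies in the kernel. -/
theorem IsSmallestSingularVector.mulVec_eq_zero {A : Matrix m n ℂ} {w v : n → ℂ}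
    (hw : IsSmallestSingularVector A w) (hv : v ≠ 0) (hAv : A.mulVec v = 0) :
    A.mulVec w = 0 := by
  have h := hw.2 _ (norm2_normalize hv)
  rw [Matrix.mulVec_smul, hAv, smul_zero, norm2_eq_zero.2 rfl] at h
  exact norm2_eq_zero.1 (le_antisymm h (norm_nonneg _))

end Norm2

/-! ### Loewner matrices and barycentric forms -/

section Loewner

variable {N : ℕ} {g : Fin (2 * N) → ℂ} {S : Finset (Fin (2 * N))}

theorem loewner_mulVec (w : {k : Fin (2 * N) // k ∈ S} → ℂ) (l : {l : Fin (2 * N) // l ∉ S}) :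
    (loewner N g S).mulVec w l = g l * baryDen N S w l - baryNum N g S w l := by
  simp only [Matrix.mulVec, dotProduct, loewner, Matrix.of_apply, baryDen, baryNum,
    Finset.mul_sum, ← Finset.sum_sub_distrib]
  exact Finset.sum_congr rfl fun k _ => by ring

/-- The nodes with index in `S`. -/
noncomputable def nodeOn (N : ℕ) (S : Finset (Fin (2 * N))) (k : {k : Fin (2 * N) // k ∈ S}) : ℂ :=
  node N k

theorem nodeOn_injective : Function.Injective (nodeOn N S) := fun _ _ h =>
  Subtype.ext (node_injective N h)

theorem node_ne_nodeOn {l : Fin (2 * N)} (hl : l ∉ S) (k : {k : Fin (2 * N) // k ∈ S}) :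
    node N l ≠ nodeOn N S k := fun h => hl (node_injective N h ▸ k.2)

/-- The numerator of `q̃` over the common denominator. -/
noncomputable def denPoly (N : ℕ) (S : Finset (Fin (2 * N))) (w : {k : Fin (2 * N) // k ∈ S} → ℂ) : ℂ[X] :=
  pfNum Finset.univ (nodeOn N S) w

/-- The numerator of `p̃` over the common denominator. -/
noncomputable def numPoly (N : ℕ) (g : Fin (2 * N) → ℂ) (S : Finset (Fin (2 * N)))
    (w : {k : Fin (2 * N) // k ∈ S} → ℂ) : ℂ[X] :=
  pfNum Finset.univ (nodeOn N S) fun k => w k * g k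

/-- The weight of the node `k ∈ S` in the barycentric form of the polynomial `q`. -/
noncomputable def baryWeight (N : ℕ) (S : Finset (Fin (2 * N))) (q : ℂ[X])
    (k : {k : Fin (2 * N) // k ∈ S}) : ℂ :=
  q.eval (node N k) / ∏ i ∈ Finset.univ.erase k, (nodeOn N S k - nodeOn N S i)

theorem degree_denPoly_lt (w : {k : Fin (2 * N) // k ∈ S} → ℂ) :
    (denPoly N S w).degree < S.card := by
  simpa [denPoly] using degree_pfNum_lt Finset.univ (nodeOn N S) w

theorem degree_numPoly_lt (w : {k : Fin (2 * N) // k ∈ S} → ℂ) :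
    (numPoly N g S w).degree < S.card := by
  simpa [numPoly] using degree_pfNum_lt Finset.univ (nodeOn N S) fun k => w k * g k

theorem baryWeight_denPoly (w : {k : Fin (2 * N) // k ∈ S} → ℂ) :
    baryWeight N S (denPoly N S w) = w := by
  funext k
  have h := eval_pfNum_of_mem (nodeOn N S) w (Finset.mem_univ k)
  rw [baryWeight, denPoly, div_eq_iff (prod_erase_sub_ne_zero nodeOn_injective.injOn
    (Finset.mem_univ k)), ← h, nodeOn]

theorem denPoly_baryWeight {q : ℂ[X]} (hq : q.degree < S.card) :
    denPoly N S (baryWeight N S q) = q :=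
  (eq_pfNum nodeOn_injective.injOn (by simpa using hq)).symm

/-- The interpolation conditions at the nodes of `S` say that the barycentric weights of `p` are
those of `q` times the data. -/
theorem numPoly_baryWeight {p q : ℂ[X]} (hp : p.degree < S.card)
    (h : ∀ k, g k * q.eval (node N k) = p.eval (node N k)) :
    numPoly N g S (baryWeight N S q) = p := by
  rw [← denPoly_baryWeight hp, numPoly, denPoly]
  congr 1
  funext k
  rw [baryWeight, baryWeight, ← h k]
  ring

theorem eval_denPoly (w : {k : Fin (2 * N) // k ∈ S} → ℂ) {l : Fin (2 * N)} (hl : l ∉ S) :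
    (denPoly N S w).eval (node N l) =
      (pfDen Finset.univ (nodeOn N S)).eval (node N l) * baryDen N S w l :=
  eval_pfNum _ _ fun k _ => node_ne_nodeOn hl k

theorem eval_numPoly (w : {k : Fin (2 * N) // k ∈ S} → ℂ) {l : Fin (2 * N)} (hl : l ∉ S) :
    (numPoly N g S w).eval (node N l) =
      (pfDen Finset.univ (nodeOn N S)).eval (node N l) * baryNum N g S w l :=
  eval_pfNum _ _ fun k _ => node_ne_nodeOn hl k

/-- The kernel of the Loewner matrix consists of the solutions of the linearized rational
interpolation problem. -/
theorem loewner_mulVec_eq_zero_iff (w : {k : Fin (2 * N) // k ∈ S} → ℂ) :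
    (loewner N g S).mulVec w = 0 ↔
      ∀ k, g k * (denPoly N S w).eval (node N k) = (numPoly N g S w).eval (node N k) := by
  constructor
  · intro h k
    by_cases hk : k ∈ S
    · have h1 := eval_pfNum_of_mem (nodeOn N S) w (Finset.mem_univ ⟨k, hk⟩)
      have h2 := eval_pfNum_of_mem (nodeOn N S) (fun k => w k * g k) (Finset.mem_univ ⟨k, hk⟩)
      rw [denPoly, numPoly, show node N k = nodeOn N S ⟨k, hk⟩ from rfl, h1, h2]
      ring
    · have h0 : g k * baryDen N S w k - baryNum N g S w k = 0 := by
        rw [← loewner_mulVec w ⟨k, hk⟩, h, Pi.zero_apply]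
      rw [eval_denPoly w hk, eval_numPoly w hk, ← sub_eq_zero.1 h0]
      ring
  · intro h
    funext l
    have h0 := h l
    rw [eval_denPoly w l.2, eval_numPoly w l.2, mul_left_comm] at h0
    have h1 : (pfDen Finset.univ (nodeOn N S)).eval (node N l) ≠ 0 :=
      eval_pfDen_ne_zero fun k _ => node_ne_nodeOn l.2 k
    rw [loewner_mulVec, mul_left_cancel₀ h1 h0, sub_self, Pi.zero_apply]

/-- If the Loewner matrix has trivial kernel, then the iteration does not stop for small
thresholds. -/
theorem exists_pos_not_stops (hS : S.Nonempty)
    (hker : ∀ w, (loewner N g S).mulVec w = 0 → w = 0) :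
    ∃ τ : ℝ, 0 < τ ∧ ∀ δ tol : ℝ, δ < τ → 0 ≤ tol → tol < τ → ∀ w, norm2 w = 1 →
      ¬ Stops N g δ tol S w := by
  have : Nonempty {k : Fin (2 * N) // k ∈ S} := hS.to_subtype
  obtain ⟨σ, hσ, hle⟩ := exists_pos_le_norm2_mulVec hker
  -- For a unit vector `w`, the inner sum bounds the barycentric denominator at `l`.
  let K : ℝ := ∑ l : {l : Fin (2 * N) // l ∉ S}, ∑ k : {k : Fin (2 * N) // k ∈ S},
    ‖node N l - node N k‖⁻¹
  have hK : 0 ≤ K := Finset.sum_nonneg fun l _ => Finset.sum_nonneg fun k _ => by positivity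
  -- The bound `σ` excludes the singular value test. The bound `σ / (K + 1)` excludes the residual
  -- test, which would give `σ ≤ K * tol`; the `+ 1` keeps the divisor positive.
  refine ⟨min σ (σ / (K + 1)), by positivity, fun δ tol hδ h0 htol w hw => ?_⟩
  rintro (h | h)
  · exact absurd ((hle w hw).trans h) (not_le.2 (hδ.trans_le (min_le_left _ _)))
  · have hbound : norm2 ((loewner N g S).mulVec w) ≤ K * tol := by
      refine (norm2_le_sum _).trans ?_
      rw [Finset.sum_mul]
      refine Finset.sum_le_sum fun l _ => ?_
      obtain ⟨hden, hres⟩ := h l l.2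
      have e : (loewner N g S).mulVec w l =
          -(baryDen N S w l * (baryNum N g S w l / baryDen N S w l - g l)) := by
        rw [loewner_mulVec]
        field_simp
        ring
      rw [e, norm_neg, norm_mul]
      refine mul_le_mul ?_ hres.le (norm_nonneg _) (Finset.sum_nonneg fun k _ => by positivity)
      refine (norm_sum_le _ _).trans (Finset.sum_le_sum fun k _ => ?_)
      rw [norm_div, div_eq_mul_inv]
      exact mul_le_of_le_one_left (by positivity) ((norm_le_norm2 w k).trans hw.le)
    have h1 : tol < σ / (K + 1) := htol.trans_le (min_le_right _ _)
    rw [lt_div_iff₀ (by positivity)] at h1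
    have := (hle w hw).trans hbound
    nlinarith

end Loewner

/-! ### Kernels of Loewner matrices of perturbed partial fractions -/

/-- The data `g` agree with the partial fraction `∑_{j ∈ s} a_j / (x - z_j)` at the nodes with
index outside of `B`, and differ from it at the nodes with index in `B`. -/
structure IsPerturbedPartialFraction {κ : Type*} (N : ℕ) (g : Fin (2 * N) → ℂ) (s : Finset κ)
    (z a : κ → ℂ) (B : Finset (Fin (2 * N))) : Prop where
  injOn : Set.InjOn z s
  coeff_ne_zero : ∀ j ∈ s, a j ≠ 0
  node_ne : ∀ j ∈ s, ∀ k, node N k ≠ z j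
  eq_of_notMem : ∀ k ∉ B, g k = ∑ j ∈ s, a j / (node N k - z j)
  ne_of_mem : ∀ k ∈ B, g k ≠ ∑ j ∈ s, a j / (node N k - z j)
  card_lt : s.card + B.card < N

namespace IsPerturbedPartialFraction

variable {κ : Type*} {N : ℕ} {g : Fin (2 * N) → ℂ} {s : Finset κ}
  {z a : κ → ℂ} {B S : Finset (Fin (2 * N))}

theorem natDegree_mul_pfDen (s : Finset κ) (z : κ → ℂ) (B : Finset (Fin (2 * N))) :
    (pfDen s z * pfDen B (node N)).natDegree = s.card + B.card := by
  rw [(pfDen_monic _ _).natDegree_mul (pfDen_monic _ _), natDegree_pfDen, natDegree_pfDen]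

/-- The weight vector spanning the kernel of the Loewner matrix of minimal size with nontrivial
kernel. -/
noncomputable def kernelVec (s : Finset κ) (z : κ → ℂ) (B S : Finset (Fin (2 * N))) :
    {k : Fin (2 * N) // k ∈ S} → ℂ :=
  baryWeight N S (pfDen s z * pfDen B (node N))

theorem degree_mul_pfDen_lt (hS : S.card = s.card + B.card + 1) :
    (pfDen s z * pfDen B (node N)).degree < S.card := by
  rw [degree_eq_natDegree ((pfDen_monic _ _).mul (pfDen_monic _ _)).ne_zero,
    natDegree_mul_pfDen, Nat.cast_lt]
  omega

/-- Up to a nonzero factor the weight is the value of `D P` at the node, and `D` has no zeros at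
nodes. -/
theorem kernelVec_eq_zero_iff (h : IsPerturbedPartialFraction N g s z a B)
    (k : {k : Fin (2 * N) // k ∈ S}) : kernelVec s z B S k = 0 ↔ (k : Fin (2 * N)) ∈ B := by
  have h1 := prod_erase_sub_ne_zero (s := Finset.univ) (nodeOn_injective (N := N) (S := S)).injOn
    (Finset.mem_univ k)
  have h2 : (pfDen s z).eval (node N k) ≠ 0 :=
    eval_pfDen_ne_zero fun j hj => h.node_ne j hj k
  rw [kernelVec, baryWeight, div_eq_zero_iff, or_iff_left h1, eval_mul, mul_eq_zero,
    or_iff_right h2]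
  constructor
  · intro h0
    by_contra hk
    exact eval_pfDen_ne_zero (fun i hi e => hk (by rwa [node_injective N e])) h0
  · intro hk
    rw [eval_pfDen]
    exact Finset.prod_eq_zero hk (sub_self _)

theorem kernelVec_ne_zero (h : IsPerturbedPartialFraction N g s z a B)
    (hS : S.card = s.card + B.card + 1) : kernelVec s z B S ≠ 0 := by
  obtain ⟨k, hk, hkB⟩ := Finset.exists_mem_notMem_of_card_lt_card (s := B) (t := S) (by omega)
  intro h0
  exact hkB ((h.kernelVec_eq_zero_iff ⟨k, hk⟩).1 (congrFun h0 _))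

variable [DecidableEq κ]

theorem exists_eq_mul (h : IsPerturbedPartialFraction N g s z a B)
    (hS : S.card ≤ s.card + B.card + 1) {w : {k : Fin (2 * N) // k ∈ S} → ℂ}
    (hw : (loewner N g S).mulVec w = 0) :
    ∃ u : ℂ[X], denPoly N S w = pfDen s z * pfDen B (node N) * u ∧
      numPoly N g S w = pfNum s z a * pfDen B (node N) * u := by
  refine exists_eq_mul_of_linearized_interpolation h.injOn h.coeff_ne_zero (node_injective N)
    h.node_ne h.eq_of_notMem h.ne_of_mem (J := S.card) ?_ (degree_numPoly_lt w)
    (degree_denPoly_lt w) ((loewner_mulVec_eq_zero_iff w).1 hw)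
  -- The count needed is `#s + #S + #B ≤ 2 (#s + #B) + 1 ≤ 2N`, which follows from `#s + #B < N`.
  have := h.card_lt
  rw [Fintype.card_fin]
  omega

/-- The denominator polynomial is a multiple of one of degree `#s + #B` but has degree less than
`#S`, so it is zero. -/
theorem eq_zero_of_mulVec_eq_zero (h : IsPerturbedPartialFraction N g s z a B)
    (hS : S.card ≤ s.card + B.card) {w : {k : Fin (2 * N) // k ∈ S} → ℂ}
    (hw : (loewner N g S).mulVec w = 0) : w = 0 := by
  obtain ⟨u, hu, -⟩ := h.exists_eq_mul (hS.trans (Nat.le_succ _)) hw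
  have hu0 : u = 0 := by
    by_contra hne
    have hq0 : denPoly N S w ≠ 0 := by
      rw [hu]
      exact mul_ne_zero ((pfDen_monic _ _).mul (pfDen_monic _ _)).ne_zero hne
    have hdeg := (natDegree_lt_iff_degree_lt hq0).2 (degree_denPoly_lt w)
    rw [hu, ((pfDen_monic _ _).mul (pfDen_monic _ _)).natDegree_mul' hne,
      natDegree_mul_pfDen] at hdeg
    omega
  rw [← baryWeight_denPoly w, hu, hu0]
  funext k
  simp [baryWeight]

/-- The pair `(A P, D P)` solves the linearized problem: off `B` the data equal `A / D`, and on `B`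
both sides vanish through `P`. -/
theorem mulVec_kernelVec (h : IsPerturbedPartialFraction N g s z a B)
    (hS : S.card = s.card + B.card + 1) :
    (loewner N g S).mulVec (kernelVec s z B S) = 0 := by
  have hdeg : (pfNum s z a * pfDen B (node N)).degree < S.card := by
    refine lt_of_le_of_lt ?_ (degree_mul_pfDen_lt (s := s) (z := z) (B := B) hS)
    rw [degree_mul, degree_mul, degree_pfDen s z]
    exact add_le_add_left (degree_pfNum_lt s z a).le _
  have heq : ∀ k, g k * (pfDen s z * pfDen B (node N)).eval (node N k) =
      (pfNum s z a * pfDen B (node N)).eval (node N k) := by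
    intro k
    by_cases hk : k ∈ B
    · have : (pfDen B (node N)).eval (node N k) = 0 := by
        rw [eval_pfDen]
        exact Finset.prod_eq_zero hk (sub_self _)
      simp [this]
    · rw [eval_mul, eval_mul, eval_pfNum z a fun j hj => h.node_ne j hj k, h.eq_of_notMem k hk]
      ring
  rw [loewner_mulVec_eq_zero_iff, kernelVec, denPoly_baryWeight (degree_mul_pfDen_lt hS),
    numPoly_baryWeight hdeg heq]
  exact heq

/-- For minimal size, the solution of the linearized interpolation problem is unique up to
scaling. -/
theorem exists_eq_C_mul (h : IsPerturbedPartialFraction N g s z a B)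
    (hS : S.card = s.card + B.card + 1) {w : {k : Fin (2 * N) // k ∈ S} → ℂ} (hw0 : w ≠ 0)
    (hw : (loewner N g S).mulVec w = 0) :
    ∃ c : ℂ, c ≠ 0 ∧ w = c • kernelVec s z B S ∧
      denPoly N S w = pfDen s z * pfDen B (node N) * C c ∧
      numPoly N g S w = pfNum s z a * pfDen B (node N) * C c := by
  obtain ⟨u, hu, hp⟩ := h.exists_eq_mul hS.le hw
  have hu0 : u ≠ 0 := by
    rintro rfl
    refine hw0 ?_
    rw [← baryWeight_denPoly w, hu]
    funext k
    simp [baryWeight]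
  have hq0 : denPoly N S w ≠ 0 := by
    rw [hu]
    exact mul_ne_zero ((pfDen_monic _ _).mul (pfDen_monic _ _)).ne_zero hu0
  have hdeg := (natDegree_lt_iff_degree_lt hq0).2 (degree_denPoly_lt w)
  rw [hu, ((pfDen_monic _ _).mul (pfDen_monic _ _)).natDegree_mul' hu0,
    natDegree_mul_pfDen] at hdeg
  rw [eq_C_of_natDegree_eq_zero (show u.natDegree = 0 by omega)] at hu hp hu0
  refine ⟨u.coeff 0, fun h0 => hu0 (by rw [h0, C_0]), ?_, hu, hp⟩
  rw [← baryWeight_denPoly w, hu]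
  funext k
  simp only [baryWeight, kernelVec, Pi.smul_apply, smul_eq_mul, eval_mul, eval_C]
  ring

/-- The nonzero weights of normalized kernel vectors are bounded away from zero. -/
theorem exists_pos_le_norm_weight (h : IsPerturbedPartialFraction N g s z a B)
    (hS : S.card = s.card + B.card + 1) :
    ∃ τ : ℝ, 0 < τ ∧ ∀ w, norm2 w = 1 → (loewner N g S).mulVec w = 0 →
      ∀ k : {k : Fin (2 * N) // k ∈ S}, (k : Fin (2 * N)) ∉ B → τ ≤ ‖w k‖ := by
  set v := kernelVec s z B S
  have hv : 0 < norm2 v := lt_of_le_of_ne (norm_nonneg _) fun e =>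
    h.kernelVec_ne_zero hS (norm2_eq_zero.1 e.symm)
  obtain ⟨τ, hτ, hle⟩ : ∃ τ : ℝ, 0 < τ ∧
      ∀ k : {k : {k : Fin (2 * N) // k ∈ S} // (k : Fin (2 * N)) ∉ B}, τ ≤ ‖v k‖ / norm2 v :=
    exists_pos_forall_le fun k => div_pos
      (norm_pos_iff.2 (mt (h.kernelVec_eq_zero_iff _).1 k.2)) hv
  refine ⟨τ, hτ, fun w hw1 hw k hk => ?_⟩
  have hw0 : w ≠ 0 := by
    rintro rfl
    rw [norm2_eq_zero.2 rfl] at hw1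
    exact zero_ne_one hw1
  obtain ⟨c, -, hc, -⟩ := h.exists_eq_C_mul hS hw0 hw
  -- Normalization fixes the modulus of the scalar, so `‖w k‖` does not depend on the choice of `w`.
  have hcn : ‖c‖ = 1 / norm2 v := by
    rw [eq_div_iff hv.ne', ← norm2_smul, ← hw1, hc]
  refine (hle ⟨k, hk⟩).trans (le_of_eq ?_)
  rw [hc, Pi.smul_apply, norm_smul, hcn]
  ring

/-- Only zero weights are deleted, so both sums are unchanged. The common denominators of the
barycentric sums cancel first, then the common factor `P c`, whose zeros are the Froissart doublets.
-/
theorem outputFun_eq (h : IsPerturbedPartialFraction N g s z a B)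
    (hS : S.card = s.card + B.card + 1) {w : {k : Fin (2 * N) // k ∈ S} → ℂ} (hw0 : w ≠ 0)
    (hw : (loewner N g S).mulVec w = 0) {ε : ℝ} (hε : ∀ k, w k ≠ 0 → ε < ‖w k‖) :
    outputFun N g ε S w = algebraMap ℂ[X] (RatFunc ℂ) (pfNum s z a) /
      algebraMap ℂ[X] (RatFunc ℂ) (pfDen s z) := by
  obtain ⟨c, hc, -, hq, hp⟩ := h.exists_eq_C_mul hS hw0 hw
  have hfilter : ∀ b : {k : Fin (2 * N) // k ∈ S} → ℂ, (∀ k, w k = 0 → b k = 0) →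
      ∑ k : {k : Fin (2 * N) // k ∈ S} with ε < ‖w k‖,
        RatFunc.C (b k) / (RatFunc.X - RatFunc.C (node N k)) =
      algebraMap ℂ[X] (RatFunc ℂ) (pfNum Finset.univ (nodeOn N S) b) /
        algebraMap ℂ[X] (RatFunc ℂ) (pfDen Finset.univ (nodeOn N S)) := by
    intro b hb
    rw [algebraMap_pfNum_div, Finset.sum_filter_of_ne]
    · rfl
    · intro k _ hk
      refine hε k fun h0 => hk ?_
      rw [hb k h0, map_zero, zero_div]
  have hne : ∀ p : ℂ[X], p ≠ 0 → algebraMap ℂ[X] (RatFunc ℂ) p ≠ 0 := fun p hp =>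
    RatFunc.algebraMap_ne_zero hp
  rw [outputFun, hfilter (fun k => w k * g k) fun k h0 => by rw [h0, zero_mul],
    hfilter w fun _ => id, div_div_div_cancel_right₀ (hne _ (pfDen_monic _ _).ne_zero)]
  change algebraMap ℂ[X] (RatFunc ℂ) (numPoly N g S w) /
    algebraMap ℂ[X] (RatFunc ℂ) (denPoly N S w) = _
  rw [hp, hq, mul_assoc, mul_assoc, map_mul, map_mul (algebraMap ℂ[X] (RatFunc ℂ)) (pfDen s z),
    mul_div_mul_right _ _ (hne _ (mul_ne_zero (pfDen_monic _ _).ne_zero (C_ne_zero.2 hc)))]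

end IsPerturbedPartialFraction

/-! ### Runs of the iteration and termination -/

section Iteration

variable {N : ℕ} {g : Fin (2 * N) → ℂ}

theorem exists_isGreedyIndex {S : Finset (Fin (2 * N))} (hS : S.card < 2 * N)
    (w : {k : Fin (2 * N) // k ∈ S} → ℂ) : ∃ k, IsGreedyIndex N g S w k := by
  have hne : Sᶜ.Nonempty := by
    rw [← Finset.card_pos, Finset.card_compl, Fintype.card_fin]
    omega
  -- Division by zero gives `0` here, which is one of the admissible conventions for `r_l`.
  obtain ⟨k, hk, hmax⟩ := Sᶜ.exists_max_image
    (fun l => ‖baryNum N g S w l / baryDen N S w l - g l‖) hne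
  exact ⟨k, Finset.mem_compl.1 hk, fun l => baryNum N g S w l / baryDen N S w l,
    fun _ _ _ => rfl, fun l hl => hmax l (Finset.mem_compl.2 hl)⟩

variable {κ : Type*} [DecidableEq κ] {s : Finset κ} {z a : κ → ℂ} {B : Finset (Fin (2 * N))}

/-- There are only finitely many index sets, so the thresholds for the individual ones have a
positive lower bound. -/
theorem IsPerturbedPartialFraction.exists_pos_forall_not_stops
    (h : IsPerturbedPartialFraction N g s z a B) :
    ∃ τ : ℝ, 0 < τ ∧ ∀ S : Finset (Fin (2 * N)), S.Nonempty → S.card ≤ s.card + B.card →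
      ∀ δ tol : ℝ, δ < τ → 0 ≤ tol → tol < τ → ∀ w, norm2 w = 1 → ¬ Stops N g δ tol S w := by
  choose t ht hhalt using fun S : {S : Finset (Fin (2 * N)) //
    S.Nonempty ∧ S.card ≤ s.card + B.card} =>
    exists_pos_not_stops (g := g) S.2.1 fun w => h.eq_zero_of_mulVec_eq_zero S.2.2
  obtain ⟨τ, hτ, hle⟩ := exists_pos_forall_le ht
  exact ⟨τ, hτ, fun S h1 h2 δ tol hδ h0 htol => hhalt ⟨S, h1, h2⟩ δ tol
    (hδ.trans_le (hle _)) h0 (htol.trans_le (hle _))⟩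

theorem IsPerturbedPartialFraction.exists_pos_forall_le_norm_weight
    (h : IsPerturbedPartialFraction N g s z a B) :
    ∃ τ : ℝ, 0 < τ ∧ ∀ S : Finset (Fin (2 * N)), S.card = s.card + B.card + 1 →
      ∀ w, norm2 w = 1 → (loewner N g S).mulVec w = 0 →
        ∀ k : {k : Fin (2 * N) // k ∈ S}, (k : Fin (2 * N)) ∉ B → τ ≤ ‖w k‖ := by
  choose t ht hw using fun S : {S : Finset (Fin (2 * N)) // S.card = s.card + B.card + 1} =>
    h.exists_pos_le_norm_weight S.2
  obtain ⟨τ, hτ, hle⟩ := exists_pos_forall_le ht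
  exact ⟨τ, hτ, fun S hS w h1 h2 k hk => (hle _).trans (hw ⟨S, hS⟩ w h1 h2 k hk)⟩

theorem Reaches.isSmallestSingularVector {δ tol : ℝ} {J : ℕ} {S : Finset (Fin (2 * N))}
    {w : {k : Fin (2 * N) // k ∈ S} → ℂ} (h : Reaches N g δ tol J S w) :
    IsSmallestSingularVector (loewner N g S) w := by
  cases h with
  | init k hk w hw => exact hw
  | step J S w S' w' h hs => exact hs.2.2

theorem Reaches.card_eq {δ tol : ℝ} {J : ℕ} {S : Finset (Fin (2 * N))}
    {w : {k : Fin (2 * N) // k ∈ S} → ℂ} (h : Reaches N g δ tol J S w) : S.card = J := by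
  induction h with
  | init k hk w hw => exact Finset.card_singleton k
  | step J S w S' w' h hs ih =>
    obtain ⟨-, ⟨k, hk, rfl⟩, -⟩ := hs
    rw [Finset.card_insert_of_notMem hk.1, ih]

theorem Reaches.pos {δ tol : ℝ} {J : ℕ} {S : Finset (Fin (2 * N))}
    {w : {k : Fin (2 * N) // k ∈ S} → ℂ} (h : Reaches N g δ tol J S w) : 0 < J := by
  cases h <;> omega

theorem exists_step {δ tol : ℝ} {S : Finset (Fin (2 * N))} (hS : S.card < 2 * N)
    {w : {k : Fin (2 * N) // k ∈ S} → ℂ} (hhalt : ¬ Stops N g δ tol S w) :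
    ∃ S' w', Step N g δ tol S w S' w' := by
  obtain ⟨k, hk⟩ := exists_isGreedyIndex (g := g) hS w
  have : Nonempty {i : Fin (2 * N) // i ∈ insert k S} := ⟨⟨k, Finset.mem_insert_self k S⟩⟩
  obtain ⟨w', hw'⟩ := exists_isSmallestSingularVector (loewner N g (insert k S))
  exact ⟨insert k S, w', hhalt, ⟨k, hk, rfl⟩, hw'⟩

theorem exists_reaches_one (hN : N ≠ 0) (g : Fin (2 * N) → ℂ) (δ tol : ℝ) :
    ∃ S w, Reaches N g δ tol 1 S w := by
  have : Nonempty (Fin (2 * N)) := ⟨⟨0, by omega⟩⟩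
  obtain ⟨k, hk⟩ := Finite.exists_max fun l => ‖g l‖
  obtain ⟨w, hw⟩ := exists_isSmallestSingularVector (loewner N g {k})
  exact ⟨{k}, w, Reaches.init k hk w hw⟩

theorem Reaches.mulVec_eq_zero (h : IsPerturbedPartialFraction N g s z a B) {δ tol : ℝ}
    {S : Finset (Fin (2 * N))} {w : {k : Fin (2 * N) // k ∈ S} → ℂ}
    (hr : Reaches N g δ tol (s.card + B.card + 1) S w) : (loewner N g S).mulVec w = 0 :=
  hr.isSmallestSingularVector.mulVec_eq_zero (h.kernelVec_ne_zero hr.card_eq)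
    (h.mulVec_kernelVec hr.card_eq)

/-- If no state of size at most `M = #s + #B` passes the stopping test, then the iteration
terminates after exactly `M + 1` steps. -/
theorem IsPerturbedPartialFraction.terminates (h : IsPerturbedPartialFraction N g s z a B)
    (hM : 0 < s.card + B.card) {δ tol : ℝ} (hδ : 0 ≤ δ)
    (hns : ∀ S : Finset (Fin (2 * N)), S.Nonempty → S.card ≤ s.card + B.card →
      ∀ w, norm2 w = 1 → ¬ Stops N g δ tol S w) :
    (∃ S w, Reaches N g δ tol (s.card + B.card + 1) S w) ∧
    ∀ J S w, Reaches N g δ tol J S w →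
      S.card = J ∧ J ≤ s.card + B.card + 1 ∧
      (Stops N g δ tol S w ↔ J = s.card + B.card + 1) ∧
      (J ≤ s.card + B.card → ∃ S' w', Step N g δ tol S w S' w') := by
  have hlt := h.card_lt
  have hrun : ∀ {J S w}, Reaches N g δ tol J S w → J ≤ s.card + B.card →
      ¬ Stops N g δ tol S w := by
    intro J S w hr hJ
    refine hns S ?_ (hr.card_eq.le.trans hJ) w hr.isSmallestSingularVector.1
    rw [← Finset.card_pos, hr.card_eq]
    exact hr.pos
  have hhalt : ∀ {S w}, Reaches N g δ tol (s.card + B.card + 1) S w →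
      Stops N g δ tol S w := by
    intro S w hr
    left
    rw [hr.mulVec_eq_zero h, norm2_eq_zero.2 rfl]
    exact hδ
  have hle : ∀ {J S w}, Reaches N g δ tol J S w → J ≤ s.card + B.card + 1 := by
    intro J S w hr
    induction hr with
    | init k hk w hw => omega
    | step J S w S' w' hr hs ih =>
      rcases ih.lt_or_eq with hJ | rfl
      · omega
      -- A run cannot pass step `M + 1`: its weight vector lies in the kernel, so the stopping test
      -- succeeds there.
      · exact absurd (hhalt hr) hs.1
  constructor
  · have hex : ∀ J, J ≤ s.card + B.card → ∃ S w, Reaches N g δ tol (J + 1) S w := by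
      intro J
      induction J with
      | zero => exact fun _ => exists_reaches_one (by omega) g δ tol
      | succ J ih =>
        intro hJ
        obtain ⟨S, w, hr⟩ := ih (by omega)
        obtain ⟨S', w', hs⟩ := exists_step (hr.card_eq.trans_lt (by omega)) (hrun hr hJ)
        exact ⟨S', w', hr.step _ _ _ _ _ hs⟩
    exact hex _ le_rfl
  · intro J S w hr
    refine ⟨hr.card_eq, hle hr, ⟨fun hs => ?_, ?_⟩, fun hJ => ?_⟩
    · by_contra hJ
      exact hrun hr (by have := hle hr; omega) hs
    · rintro rfl
      exact hhalt hr
    · exact exists_step (hr.card_eq.trans_lt (by omega)) (hrun hr hJ)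

end Iteration

/-! ### Reading off poles, residues and values -/

section Output

variable {N : ℕ} {g : Fin (2 * N) → ℂ} {κ : Type*} [DecidableEq κ] {s : Finset κ}
  {z a : κ → ℂ} {B S : Finset (Fin (2 * N))}

/-- The output function of the iteration is the partial fraction underlying the data. -/
theorem IsPerturbedPartialFraction.outputFun_eq_and_sigmaOne_eq
    (h : IsPerturbedPartialFraction N g s z a B) (hS : S.card = s.card + B.card + 1)
    {w : {k : Fin (2 * N) // k ∈ S} → ℂ} (hw1 : norm2 w = 1)
    (hw : (loewner N g S).mulVec w = 0) {ε : ℝ} (hε0 : 0 ≤ ε)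
    (hε : ∀ k : {k : Fin (2 * N) // k ∈ S}, (k : Fin (2 * N)) ∉ B → ε < ‖w k‖) :
    outputFun N g ε S w = algebraMap ℂ[X] (RatFunc ℂ) (pfNum s z a) /
        algebraMap ℂ[X] (RatFunc ℂ) (pfDen s z) ∧
      sigmaOne N ε S w = {k | k ∈ S ∧ k ∈ B} := by
  have hw0 : w ≠ 0 := by
    rintro rfl
    rw [norm2_eq_zero.2 rfl] at hw1
    exact zero_ne_one hw1
  have hB : ∀ k : {k : Fin (2 * N) // k ∈ S}, (k : Fin (2 * N)) ∈ B → w k = 0 := by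
    intro k hk
    obtain ⟨c, -, hc, -⟩ := h.exists_eq_C_mul hS hw0 hw
    rw [hc, Pi.smul_apply, (h.kernelVec_eq_zero_iff k).2 hk, smul_zero]
  refine ⟨h.outputFun_eq hS hw0 hw fun k hk => hε k (mt (hB k) hk), Set.ext fun k => ⟨?_, ?_⟩⟩
  · rintro ⟨hk, hle⟩
    refine ⟨hk, ?_⟩
    by_contra hkB
    exact absurd (hε ⟨k, hk⟩ hkB) (not_lt.2 hle)
  · rintro ⟨hk, hkB⟩
    refine ⟨hk, ?_⟩
    rw [hB ⟨k, hk⟩ hkB, norm_zero]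
    exact hε0

theorem value_eq_of_num_denom {r : RatFunc ℂ} (hnum : r.num = pfNum s z a)
    (hden : r.denom = pfDen s z) {x : ℂ} (hx : ∀ j ∈ s, x ≠ z j) :
    value r x = ∑ j ∈ s, a j / (x - z j) := by
  rw [value, hnum, hden, eval_pfNum z a hx, mul_div_cancel_left₀ _ (eval_pfDen_ne_zero hx)]

/-- The simple poles of a partial fraction and the residues there. -/
theorem recoveredOne_eq_of_num_denom {r : RatFunc ℂ} (hz : Set.InjOn z s)
    (hnum : r.num = pfNum s z a) (hden : r.denom = pfDen s z) :
    recoveredOne N r = {p | ∃ j ∈ s, p = (z j, a j / (1 - z j ^ (2 * N)))} := by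
  have hres : ∀ j ∈ s, r.num.eval (z j) / r.denom.derivative.eval (z j) = a j := by
    intro j hj
    rw [hnum, hden, eval_pfNum_of_mem z a hj, eval_derivative_pfDen z hj,
      mul_div_cancel_right₀ _ (prod_erase_sub_ne_zero hz hj)]
  ext ⟨x, c⟩
  simp only [recoveredOne, Set.mem_ofPred_eq, Prod.mk.injEq]
  constructor
  · rintro ⟨hx, hc⟩
    rw [IsRoot, hden, eval_pfDen, Finset.prod_eq_zero_iff] at hx
    obtain ⟨j, hj, hxj⟩ := hx
    rw [sub_eq_zero] at hxj
    subst hxj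
    exact ⟨j, hj, rfl, by rw [hc, hres j hj]⟩
  · rintro ⟨j, hj, rfl, rfl⟩
    refine ⟨?_, by rw [hres j hj]⟩
    rw [IsRoot, hden, eval_pfDen]
    exact Finset.prod_eq_zero hj (sub_self _)

end Output

/-! ### Exponential sums as perturbed partial fractions -/

section ExponentialSums

variable {M₁ M N : ℕ} {γ z : Fin M → ℂ}

/-- The indices of the nodes which are knots of the `2N`-periodic part of the exponential sum. -/
noncomputable def periodicIndices (M₁ N : ℕ) {M : ℕ} (z : Fin M → ℂ) : Finset (Fin (2 * N)) :=
  open Classical in {k | ∃ j : Fin M, M₁ ≤ (j : ℕ) ∧ z j = node N k}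

theorem mem_periodicIndices {k : Fin (2 * N)} :
    k ∈ periodicIndices M₁ N z ↔ ∃ j : Fin M, M₁ ≤ (j : ℕ) ∧ z j = node N k := by
  simp [periodicIndices]

/-- Sending a periodic knot to the index of its node is injective because `z` is, so the periodic
knots and their indices are equinumerous. -/
theorem card_add_card_periodicIndices (hinj : Function.Injective z)
    (hper : ∀ j : Fin M, M₁ ≤ (j : ℕ) → ∃ k : Fin (2 * N), z j = node N k) :
    ({j : Fin M | (j : ℕ) < M₁} : Finset (Fin M)).card + (periodicIndices M₁ N z).card = M := by
  choose k hk using hper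
  have hB : periodicIndices M₁ N z =
      Finset.univ.image fun j : {j : Fin M // ¬ (j : ℕ) < M₁} => k j (not_lt.1 j.2) := by
    ext i
    simp only [mem_periodicIndices, Finset.mem_image, Finset.mem_univ, true_and]
    constructor
    · rintro ⟨j, hj, hji⟩
      exact ⟨⟨j, not_lt.2 hj⟩, node_injective N ((hk j hj).symm.trans hji)⟩
    · rintro ⟨j, rfl⟩
      exact ⟨j, not_lt.1 j.2, hk j _⟩
  rw [hB, Finset.card_image_of_injective, Finset.card_univ, Fintype.card_subtype,
    Finset.card_filter_add_card_filter_not, Finset.card_univ, Fintype.card_fin]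
  intro i j hij
  refine Subtype.ext (hinj ?_)
  rw [hk i (not_lt.1 i.2), hk j (not_lt.1 j.2)]
  exact congrArg _ hij

theorem scaledDft_expSum_of_ne {s : Finset (Fin M)}
    (hreg : ∀ j ∈ s, ∀ k : Fin (2 * N), z j ≠ node N k) (k : Fin (2 * N)) :
    scaledDft N (expSum s γ z) k =
      ∑ j ∈ s, γ j * (1 - z j ^ (2 * N)) / (node N k - z j) := by
  rw [scaledDft_expSum]
  exact Finset.sum_congr rfl fun j hj => by rw [scaledDft_pow_of_ne (hreg j hj k), mul_div_assoc]

theorem scaledDft_expSum_univ (s : Finset (Fin M)) (k : Fin (2 * N)) :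
    scaledDft N (expSum Finset.univ γ z) k = scaledDft N (expSum s γ z) k +
      ∑ j ∈ sᶜ, γ j * scaledDft N (fun t => z j ^ t) k := by
  rw [scaledDft_expSum, scaledDft_expSum, Finset.sum_add_sum_compl]

theorem scaledDft_univ_of_notMem_periodicIndices
    (hper : ∀ j : Fin M, M₁ ≤ (j : ℕ) → ∃ k : Fin (2 * N), z j = node N k)
    {k : Fin (2 * N)} (hk : k ∉ periodicIndices M₁ N z) :
    scaledDft N (expSum Finset.univ γ z) k =
      scaledDft N (expSum {j : Fin M | (j : ℕ) < M₁} γ z) k := by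
  rw [scaledDft_expSum_univ {j : Fin M | (j : ℕ) < M₁}, add_eq_left]
  refine Finset.sum_eq_zero fun j hj => ?_
  have hj' : M₁ ≤ (j : ℕ) := by simpa using hj
  obtain ⟨l, hl⟩ := hper j hj'
  rw [hl, scaledDft_pow_node_of_ne, mul_zero]
  rintro rfl
  exact hk (mem_periodicIndices.2 ⟨j, hj', hl⟩)

theorem scaledDft_univ_of_eq_node (hinj : Function.Injective z)
    (hper : ∀ j : Fin M, M₁ ≤ (j : ℕ) → ∃ k : Fin (2 * N), z j = node N k)
    {k : Fin (2 * N)} {j : Fin M} (hj : M₁ ≤ (j : ℕ)) (hjk : z j = node N k) :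
    scaledDft N (expSum Finset.univ γ z) k =
      scaledDft N (expSum {j : Fin M | (j : ℕ) < M₁} γ z) k +
        γ j * (2 * N * dftRoot N ^ (k : ℕ)) := by
  rw [scaledDft_expSum_univ {j : Fin M | (j : ℕ) < M₁}, add_right_inj,
    Finset.sum_eq_single_of_mem j (by simpa using hj), hjk, scaledDft_pow_self]
  intro i hi hij
  obtain ⟨l, hl⟩ := hper i (by simpa using hi)
  rw [hl, scaledDft_pow_node_of_ne, mul_zero]
  rintro rfl
  exact hij (hinj (hl.trans hjk.symm))

/-- A coefficient could vanish only if `z j ^ (2 * N) = 1`, that is, if `z j` were a node. On `B`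
the perturbation is `2 N ω^k γ_j`, which is nonzero. -/
theorem isPerturbedPartialFraction_scaledDft (hMN : M < N) (hγ : ∀ j, γ j ≠ 0)
    (hinj : Function.Injective z)
    (hreg : ∀ j : Fin M, (j : ℕ) < M₁ → ∀ k : Fin (2 * N), z j ≠ node N k)
    (hper : ∀ j : Fin M, M₁ ≤ (j : ℕ) → ∃ k : Fin (2 * N), z j = node N k) :
    IsPerturbedPartialFraction N (scaledDft N (expSum Finset.univ γ z))
      ({j : Fin M | (j : ℕ) < M₁} : Finset (Fin M)) z (fun j => γ j * (1 - z j ^ (2 * N)))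
      (periodicIndices M₁ N z) := by
  have hreg' : ∀ j ∈ ({j : Fin M | (j : ℕ) < M₁} : Finset (Fin M)), ∀ k, z j ≠ node N k :=
    fun j hj => hreg j (by simpa using hj)
  refine ⟨hinj.injOn, fun j hj h0 => ?_, fun j hj k => (hreg' j hj k).symm, fun k hk => ?_,
    fun k hk => ?_, by rwa [card_add_card_periodicIndices hinj hper]⟩
  · rcases mul_eq_zero.1 h0 with h0 | h0
    · exact hγ j h0
    · obtain ⟨k, hk⟩ := exists_node_eq (by omega : N ≠ 0) (sub_eq_zero.1 h0).symm
      exact hreg' j hj k hk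
  · rw [scaledDft_univ_of_notMem_periodicIndices hper hk, scaledDft_expSum_of_ne hreg']
  · obtain ⟨j, hj, hjk⟩ := mem_periodicIndices.1 hk
    rw [scaledDft_univ_of_eq_node hinj hper hj hjk, scaledDft_expSum_of_ne hreg', Ne,
      add_eq_left]
    have hN : (N : ℂ) ≠ 0 := Nat.cast_ne_zero.2 (by omega)
    exact mul_ne_zero (hγ j) (mul_ne_zero (mul_ne_zero two_ne_zero hN)
      (pow_ne_zero _ (dftRoot_ne_zero N)))

end ExponentialSums

end ESPIRA

/-! ### The main theorem -/

theorem mainTheorem4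
    (M₁ M N : ℕ) (hM₁ : M₁ < M) (hMN : M < N)
    (γ z : Fin M → ℂ)
    (hγ : ∀ j, γ j ≠ 0) (hz : ∀ j, z j ≠ 0) (hinj : Function.Injective z)
    (hreg : ∀ j : Fin M, (j : ℕ) < M₁ → ∀ k : Fin (2 * N), z j ≠ ESPIRA.node N k)
    (hper : ∀ j : Fin M, M₁ ≤ (j : ℕ) → ∃ k : Fin (2 * N), z j = ESPIRA.node N k)
    (f f₁ : ℕ → ℂ) (hf : f = ESPIRA.expSum Finset.univ γ z)
    (hf₁ : f₁ = ESPIRA.expSum {j : Fin M | (j : ℕ) < M₁} γ z)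
    (g : Fin (2 * N) → ℂ) (hg : g = ESPIRA.scaledDft N f) :
    ∃ τ : ℝ, 0 < τ ∧ ∀ δ ε tol : ℝ,
      0 ≤ δ → δ < τ → 0 ≤ ε → ε < τ → 0 ≤ tol → tol < τ →
      -- the iteration terminates after exactly `M + 1` steps
      (∃ S w, ESPIRA.Reaches N g δ tol (M + 1) S w) ∧
      (∀ J S w, ESPIRA.Reaches N g δ tol J S w →
        S.card = J ∧ J ≤ M + 1 ∧
        (ESPIRA.Stops N g δ tol S w ↔ J = M + 1) ∧
        (J ≤ M → ∃ S' w', ESPIRA.Step N g δ tol S w S' w')) ∧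
      -- properties of the output of every run
      (∀ S w, ESPIRA.Reaches N g δ tol (M + 1) S w →
        (ESPIRA.loewner N g S).mulVec w = 0 ∧
        ∀ r : RatFunc ℂ, r = ESPIRA.outputFun N g ε S w →
        ∀ T : Set (Fin (2 * N)),
          T = ESPIRA.sigmaOne N ε S w ∪ ESPIRA.sigmaTwo N g tol S r →
          -- type `(M₁ - 1, M₁)`
          r.num.degree < (M₁ : WithBot ℕ) ∧ r.denom.natDegree = M₁ ∧
          -- interpolation of the scaled DFT of `f₁` at all nodes
          (∀ l : Fin (2 * N), r.denom.eval (ESPIRA.node N l) ≠ 0 ∧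
            ESPIRA.value r (ESPIRA.node N l) = ESPIRA.scaledDft N f₁ l) ∧
          -- identification of the knots of `f₂`
          T = {k | ∃ j : Fin M, M₁ ≤ (j : ℕ) ∧ z j = ESPIRA.node N k} ∧
          -- recovery of all parameters
          r = ∑ j ∈ ({j : Fin M | (j : ℕ) < M₁} : Finset (Fin M)),
            RatFunc.C (γ j * (1 - z j ^ (2 * N))) / (RatFunc.X - RatFunc.C (z j)) ∧
          ESPIRA.recoveredOne N r =
            {p | ∃ j : Fin M, (j : ℕ) < M₁ ∧ p = (z j, γ j)} ∧
          ESPIRA.recoveredTwo N g T r =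
            {p | ∃ j : Fin M, M₁ ≤ (j : ℕ) ∧ p = (z j, γ j)}) := by
  classical
  set s : Finset (Fin M) := {j : Fin M | (j : ℕ) < M₁} with hs
  set a : Fin M → ℂ := fun j => γ j * (1 - z j ^ (2 * N)) with ha
  set B := ESPIRA.periodicIndices M₁ N z with hB
  have hcard : s.card + B.card = M := ESPIRA.card_add_card_periodicIndices hinj hper
  have hscard : s.card = M₁ := by
    rw [hs, Fin.card_filter_val_lt, min_eq_right hM₁.le]
  have hreg' : ∀ j ∈ s, ∀ k : Fin (2 * N), z j ≠ ESPIRA.node N k :=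
    fun j hj => hreg j (by simpa [hs] using hj)
  have hN : (N : ℂ) ≠ 0 := Nat.cast_ne_zero.2 (by omega)
  have h : ESPIRA.IsPerturbedPartialFraction N g s z a B := by
    rw [hg, hf]
    exact ESPIRA.isPerturbedPartialFraction_scaledDft hMN hγ hinj hreg hper
  have hval : ∀ k : Fin (2 * N), ESPIRA.scaledDft N f₁ k =
      ∑ j ∈ s, a j / (ESPIRA.node N k - z j) := by
    rw [hf₁]
    exact ESPIRA.scaledDft_expSum_of_ne hreg'
  have hgper : ∀ (k : Fin (2 * N)) (j : Fin M), M₁ ≤ (j : ℕ) → z j = ESPIRA.node N k →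
      g k = ESPIRA.scaledDft N f₁ k + γ j * (2 * N * ESPIRA.dftRoot N ^ (k : ℕ)) := by
    intro k j hj hjk
    rw [hg, hf, hf₁]
    exact ESPIRA.scaledDft_univ_of_eq_node hinj hper hj hjk
  obtain ⟨τ₁, hτ₁, hhalt⟩ := h.exists_pos_forall_not_stops
  obtain ⟨τ₂, hτ₂, hweight⟩ := h.exists_pos_forall_le_norm_weight
  -- The smallest perturbation on `B` bounds `tol` so that every index of `B` left in `Γ` is
  -- detected by its residual.
  obtain ⟨τ₃, hτ₃, hgap⟩ := ESPIRA.exists_pos_forall_le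
    (f := fun k : {k // k ∈ B} => ‖ESPIRA.scaledDft N f₁ k - g k‖) fun k => by
      rw [norm_pos_iff, sub_ne_zero, hval]
      exact (h.ne_of_mem k k.2).symm
  -- `τ₁` prevents early stopping, `τ₂` keeps `ε` below all nonzero weights, and `τ₃` separates the
  -- perturbed data.
  refine ⟨min τ₁ (min τ₂ τ₃), by positivity, fun δ ε tol hδ0 hδ hε0 hε htol0 htol => ?_⟩
  simp only [lt_min_iff] at hδ hε htol
  have hrun := h.terminates (by omega) hδ0 fun S hne hS w hw =>
    hhalt S hne hS δ tol hδ.1 htol0 htol.1 w hw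
  rw [hcard] at hrun
  refine ⟨hrun.1, hrun.2, fun S w hr => ?_⟩
  have hS : S.card = s.card + B.card + 1 := by rw [hcard, hr.card_eq]
  have hw1 := hr.isSmallestSingularVector.1
  have hker : (ESPIRA.loewner N g S).mulVec w = 0 := by
    rw [← hcard] at hr
    exact hr.mulVec_eq_zero h
  refine ⟨hker, fun r hrdef T hT => ?_⟩
  obtain ⟨hout, hsig⟩ := h.outputFun_eq_and_sigmaOne_eq hS hw1 hker hε0 fun k hk =>
    hε.2.1.trans_le (hweight S hS w hw1 hker k hk)
  rw [← hrdef] at hout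
  obtain ⟨hnum, hden⟩ := ESPIRA.num_denom_of_isCoprime (ESPIRA.pfDen_monic s z)
    (ESPIRA.isCoprime_pfNum_pfDen h.injOn h.coeff_ne_zero) hout
  have hvalue : ∀ k : Fin (2 * N),
      ESPIRA.value r (ESPIRA.node N k) = ESPIRA.scaledDft N f₁ k := fun k => by
    rw [hval, ESPIRA.value_eq_of_num_denom hnum hden fun j hj => h.node_ne j hj k]
  have hTB : T = {k | k ∈ B} := by
    rw [hT, hsig]
    ext k
    simp only [ESPIRA.sigmaTwo, Set.mem_union, Set.mem_ofPred_eq, hvalue]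
    constructor
    · rintro (⟨-, hk⟩ | ⟨-, hk⟩)
      · exact hk
      · by_contra hkB
        rw [hval, ← h.eq_of_notMem k hkB, sub_self, norm_zero] at hk
        exact absurd hk (not_lt.2 htol0)
    · intro hk
      by_cases hkS : k ∈ S
      · exact Or.inl ⟨hkS, hk⟩
      · exact Or.inr ⟨hkS, htol.2.2.trans_le (hgap ⟨k, hk⟩)⟩
  have hTj : T = {k | ∃ j : Fin M, M₁ ≤ (j : ℕ) ∧ z j = ESPIRA.node N k} := by
    rw [hTB]
    ext k
    exact ESPIRA.mem_periodicIndices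
  refine ⟨?_, ?_, fun l => ⟨?_, hvalue l⟩, hTj, ?_, ?_, ?_⟩
  · rw [hnum, ← hscard]
    exact ESPIRA.degree_pfNum_lt s z a
  · rw [hden, ESPIRA.natDegree_pfDen, hscard]
  · rw [hden]
    exact ESPIRA.eval_pfDen_ne_zero fun j hj => h.node_ne j hj l
  · rw [hout, ESPIRA.algebraMap_pfNum_div]
  · rw [ESPIRA.recoveredOne_eq_of_num_denom h.injOn hnum hden]
    -- The divisor is nonzero because it is a factor of the nonzero coefficient `a j`.
    have hquot : ∀ j ∈ s, a j / (1 - z j ^ (2 * N)) = γ j := fun j hj =>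
      mul_div_cancel_right₀ _ (right_ne_zero_of_mul (h.coeff_ne_zero j hj))
    ext p
    refine exists_congr fun j => ?_
    have hmem : j ∈ s ↔ (j : ℕ) < M₁ := by simp [hs]
    rw [← hmem]
    exact and_congr_right fun hj => by rw [hquot j hj]
  · rw [hTj]
    ext ⟨x, c⟩
    simp only [ESPIRA.recoveredTwo, Set.mem_ofPred_eq, Prod.mk.injEq, hvalue]
    have hquot : ∀ (k : Fin (2 * N)) (j : Fin M), M₁ ≤ (j : ℕ) → z j = ESPIRA.node N k →
        (g k - ESPIRA.scaledDft N f₁ k) / (2 * N * ESPIRA.dftRoot N ^ (k : ℕ)) = γ j := by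
      intro k j hj hjk
      rw [hgper k j hj hjk, add_sub_cancel_left, mul_div_cancel_right₀]
      exact mul_ne_zero (mul_ne_zero two_ne_zero hN) (pow_ne_zero _ (ESPIRA.dftRoot_ne_zero N))
    constructor
    · rintro ⟨k, ⟨j, hj, hjk⟩, rfl, rfl⟩
      exact ⟨j, hj, hjk.symm, hquot k j hj hjk⟩
    · rintro ⟨j, hj, rfl, rfl⟩
      obtain ⟨k, hk⟩ := hper j hj
      exact ⟨k, ⟨j, hj, hk⟩, hk, (hquot k j hj hk).symm⟩
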